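/- Let $X$ be a compact connected topological manifold, $\pi':\widetilde X\to X$ its universal covering, and $\Theta$ the deck transformation group of $\pi'$, i.e. the group of homeomorphisms $\theta$ of $\widetilde X$ with $\pi'\circ\theta=\pi'$. Let $T:X\to X$ be a homeomorphism and $f:X\to\mathbb R$ a continuous function that is everywhere positive or everywhere negative. Let $T_{-f}(x,r)=(Tx,r-f(x))$ on $X\times\mathbb R$, let $X^f$ be the quotient of $X\times\mathbb R$ by the orbit equivalence relation of $T_{-f}$, and let $T^f=(T^f_t)_{t\in\mathbb R}$ be the continuous flow on $X^f$ induced by $\sigma_t(x,r)=(x,r+t)$ (for $f>0$ this is the special flow over $T$ under the roof function $f$). Let $I_{top}(T^f)$ be the group of all $s\in\mathbb R^*=\mathbb R\setminus\{0\}$ such that the flows $(T^f_t)_{t\in\mathbb R}$ and $(T^f_{st})_{t\in\mathbb R}$ are topologically conjugate, i.e. $S\circ T^f_t=T^f_{st}\circ S$ for all $t$ for some homeomorphism $S$ of $X^f$. Let $\widetilde T:\widetilde X\to\widetilde X$ be a homeomorphism lifting $T$, i.e. $\pi'\circ\widetilde T=T\circ\pi'$, and put $\widetilde f=f\circ\pi'$.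 For $m\in\mathbb Z$ let $\widetilde f^{(m)}=\sum_{i=0}^{m-1}\widetilde f\circ\widetilde T^i$ if $m>0$, $\widetilde f^{(0)}=0$, and $\widetilde f^{(m)}=-\sum_{i=m}^{-1}\widetilde f\circ\widetilde T^i$ if $m<0$. Let $\gamma(\theta)=\widetilde T\circ\theta\circ\widetilde T^{-1}$ for $\theta\in\Theta$, and let $\Theta\rtimes_\gamma\mathbb Z$ be the semidirect product with multiplication $(\theta,m)\cdot(\theta',m')=(\theta\circ\gamma^m(\theta'),m+m')$. It acts on $\widetilde X$ by $(\theta,m)(\widetilde x)=\theta(\widetilde T^m\widetilde x)$. Then for every $s\in\mathbb R^*$ (in particular for every $s\in\mathbb R^*\setminus\{1\}$), $s\in I_{top}(T^f)$ if and only if there exist a homeomorphism $V:\widetilde X\to\widetilde X$, a group automorphism $A=(A_1,A_2)$ of $\Theta\rtimes_\gamma\mathbb Z$ (with $A_1$ valued in $\Theta$ and $A_2$ in $\mathbb Z$) and a continuous function $g:\widetilde X\to\mathbb R$ such that for all $(\theta,m)\in\Theta\rtimes_\gamma\mathbb Z$ and all $\widetilde x\in\widetilde X$ $$V\big((\theta,m)(\widetilde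 x)\big)=A(\theta,m)\big(V(\widetilde x)\big),$$ $$s\,\widetilde f^{(A_2(\theta,m))}(V(\widetilde x))-\widetilde f^{(m)}(\widetilde x)=g(\widetilde x)-g\big((\theta,m)(\widetilde x)\big).$$ -/

import Mathlib

namespace SpecialFlow

/-! ### Topological self-similarity of a continuous flow -/

section SelfSimilarity

/-- The flow `φ ∘ s = (φ_{s t})_{t ∈ ℝ}`. -/
def rescale {Y : Type*} [TopologicalSpace Y] (φ : Flow ℝ Y) (s : ℝ) : Flow ℝ Y where
  toFun t y := φ (s * t) y
  cont' := φ.cont'.comp ((continuous_const.mul continuous_fst).prodMk continuous_snd)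
  map_add' t₁ t₂ y := by rw [mul_add, φ.map_add]
  map_zero' y := by rw [mul_zero, φ.map_zero_apply]

/-- Two continuous flows are topologically conjugate if some homeomorphism intertwines them. -/
def TopConjugate {Y Z : Type*} [TopologicalSpace Y] [TopologicalSpace Z]
    (φ : Flow ℝ Y) (ψ : Flow ℝ Z) : Prop :=
  ∃ S : Y ≃ₜ Z, ∀ (t : ℝ) (y : Y), S (φ t y) = ψ t (S y)

/-- The group `I_top(φ)` of all `s ∈ ℝ*` such that `φ` and `φ ∘ s` are topologically conjugate. -/
def topSelfSimilarityGroup {Y : Type*} [TopologicalSpace Y] (φ : Flow ℝ Y) : Subgroup ℝˣ where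
  carrier := {s | TopConjugate φ (rescale φ (s : ℝ))}
  one_mem' := ⟨Homeomorph.refl Y, fun t y => by simp [rescale]⟩
  mul_mem' := by
    rintro a b ⟨S, hS⟩ ⟨R, hR⟩
    refine ⟨R.trans S, fun t y => ?_⟩
    have h1 := hR t y
    have h2 := hS ((b : ℝ) * t) (R y)
    simp only [rescale] at h1 h2
    simp only [rescale, Homeomorph.trans_apply, h1, h2, Units.val_mul, mul_assoc]
  inv_mem' := by
    rintro a ⟨S, hS⟩
    refine ⟨S.symm, fun t y => ?_⟩
    have h := hS ((↑a⁻¹ : ℝ) * t) (S.symm y)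
    simp only [rescale, Homeomorph.apply_symm_apply, ← mul_assoc, Units.mul_inv, one_mul] at h
    simp only [rescale, ← h, Homeomorph.symm_apply_apply]

end SelfSimilarity

/-! ### The special flow as a quotient of the vertical translation flow on `X × ℝ` -/

section Quotient

variable {X : Type*} [TopologicalSpace X]

/-- The skew product `T_{-f}(x, r) = (T x, r - f x)` as a homeomorphism of `X × ℝ`. -/
def skewProduct (T : X ≃ₜ X) (f : C(X, ℝ)) : (X × ℝ) ≃ₜ (X × ℝ) where
  toFun q := (T q.1, q.2 - f q.1)
  invFun q := (T.symm q.1, q.2 + f (T.symm q.1))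
  left_inv q := by simp
  right_inv q := by simp
  continuous_toFun := by fun_prop
  continuous_invFun := by fun_prop

/-- The vertical translation `σ_t(x, r) = (x, r + t)`. -/
def vertical (t : ℝ) (q : X × ℝ) : X × ℝ := (q.1, q.2 + t)

/-- The orbit equivalence relation of `T_{-f}` on `X × ℝ`. -/
def orbitSetoid (T : X ≃ₜ X) (f : C(X, ℝ)) : Setoid (X × ℝ) where
  r p q := ∃ n : ℤ, q = (skewProduct T f ^ n) p
  iseqv :=
    { refl := fun p => ⟨0, by simp⟩
      symm := by
        rintro p _ ⟨n, rfl⟩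
        refine ⟨-n, ?_⟩
        rw [← Homeomorph.mul_apply, ← zpow_add, neg_add_cancel, zpow_zero, Homeomorph.one_apply]
      trans := by
        rintro p _ _ ⟨n, rfl⟩ ⟨m, rfl⟩
        exact ⟨m + n, by rw [zpow_add, Homeomorph.mul_apply]⟩ }

/-- The space `X^f = (X × ℝ)/≡`, with the quotient topology. -/
abbrev Space (T : X ≃ₜ X) (f : C(X, ℝ)) : Type _ := Quotient (orbitSetoid T f)

theorem skewProduct_zpow_vertical (T : X ≃ₜ X) (f : C(X, ℝ)) (n : ℤ) (t : ℝ) (q : X × ℝ) :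
    (skewProduct T f ^ n) (vertical t q) = vertical t ((skewProduct T f ^ n) q) := by
  let σ : (X × ℝ) ≃ₜ (X × ℝ) := (Homeomorph.refl X).prodCongr (Homeomorph.addRight t)
  have hc : Commute (skewProduct T f) σ := by
    ext q
    · rfl
    · change q.2 + t - f q.1 = q.2 - f q.1 + t
      ring
  have h := hc.zpow_left n
  exact DFunLike.congr_fun h.eq q

theorem isOpenQuotientMap_mk (T : X ≃ₜ X) (f : C(X, ℝ)) :
    IsOpenQuotientMap (Quotient.mk (orbitSetoid T f)) := by
  refine ⟨Quotient.mk_surjective, continuous_quotient_mk', fun U hU => ?_⟩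
  rw [← isQuotientMap_quotient_mk'.isOpen_preimage]
  have : Quotient.mk (orbitSetoid T f) ⁻¹' (Quotient.mk (orbitSetoid T f) '' U) =
      ⋃ n : ℤ, (skewProduct T f ^ n) ⁻¹' U := by
    ext q
    simp only [Set.mem_preimage, Set.mem_image, Set.mem_iUnion]
    constructor
    · rintro ⟨p, hp, h⟩
      obtain ⟨n, hn⟩ := (orbitSetoid T f).symm (Quotient.exact h)
      exact ⟨n, hn ▸ hp⟩
    · rintro ⟨n, hn⟩
      exact ⟨_, hn, Quotient.sound ((orbitSetoid T f).symm ⟨n, rfl⟩)⟩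
  change IsOpen (Quotient.mk (orbitSetoid T f) ⁻¹' _)
  rw [this]
  exact isOpen_iUnion fun n => hU.preimage (skewProduct T f ^ n).continuous

/-- The flow `T^f` on `X^f` induced by `σ_t` (for `f > 0` it is the special flow over `T` under the
roof function `f`). -/
def specialFlow (T : X ≃ₜ X) (f : C(X, ℝ)) : Flow ℝ (Space T f) where
  toFun t := Quotient.map (vertical t) (by
    rintro p _ ⟨n, rfl⟩
    exact ⟨n, (skewProduct_zpow_vertical T f n t p).symm⟩)
  cont' := by
    rw [← (IsOpenQuotientMap.id.prodMap (isOpenQuotientMap_mk T f)).continuous_comp_iff]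
    have : Continuous fun a : ℝ × (X × ℝ) => Quotient.mk (orbitSetoid T f) (vertical a.1 a.2) :=
      continuous_quotient_mk'.comp (by unfold vertical; fun_prop)
    exact this
  map_add' t₁ t₂ y := by
    induction y using Quotient.inductionOn with
    | h q =>
      change Quotient.mk (orbitSetoid T f) _ = Quotient.mk (orbitSetoid T f) _
      congr 1
      exact Prod.ext rfl (by simp only [vertical]; ring)
  map_zero' y := by
    induction y using Quotient.inductionOn with
    | h q =>
      change Quotient.mk (orbitSetoid T f) _ = Quotient.mk (orbitSetoid T f) _
      congr 1
      exact Prod.ext rfl (by simp [vertical])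

end Quotient

/-- The cocycle `h^{(k)}` over a homeomorphism `R`: it is `h(y) + ⋯ + h(R^{k-1} y)` for `k > 0`, `0`
for `k = 0`, and `-(h(R^k y) + ⋯ + h(R^{-1} y))` for `k < 0`. -/
noncomputable def cocycle {Y : Type*} [TopologicalSpace Y] (R : Y ≃ₜ Y) (h : Y → ℝ) (k : ℤ)
    (y : Y) : ℝ :=
  ∑ i ∈ Finset.Ico 0 k, h ((R ^ i) y) - ∑ i ∈ Finset.Ico k 0, h ((R ^ i) y)

/-! ### Deck transformations and the semidirect product -/

section Deck

variable {X E : Type*} [TopologicalSpace X] [TopologicalSpace E]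

/-- The group of homeomorphisms `θ` of `E` with `p ∘ θ = p`. -/
def deckGroup (p : E → X) : Subgroup (E ≃ₜ E) where
  carrier := {θ | ∀ x, p (θ x) = p x}
  one_mem' x := rfl
  mul_mem' {a b} ha hb x := by rw [Homeomorph.mul_apply, ha, hb]
  inv_mem' {a} ha x := by
    have h := ha (a⁻¹ x)
    rwa [← Homeomorph.mul_apply, mul_inv_cancel, Homeomorph.one_apply, eq_comm] at h

theorem conj_mem_deckGroup {p : E → X} {T : X ≃ₜ X} {R : E ≃ₜ E} (hR : ∀ x, p (R x) = T (p x))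
    {θ : E ≃ₜ E} (hθ : θ ∈ deckGroup p) : R * θ * R⁻¹ ∈ deckGroup p := fun x => by
  have h : R (R⁻¹ x) = x := by
    rw [← Homeomorph.mul_apply, mul_inv_cancel, Homeomorph.one_apply]
  rw [Homeomorph.mul_apply, Homeomorph.mul_apply, hR, hθ, ← hR, h]

theorem conj_inv_mem_deckGroup {p : E → X} {T : X ≃ₜ X} {R : E ≃ₜ E}
    (hR : ∀ x, p (R x) = T (p x)) {θ : E ≃ₜ E} (hθ : θ ∈ deckGroup p) :
    R⁻¹ * θ * R ∈ deckGroup p := fun x => T.injective <| by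
  have h : ∀ y, R (R⁻¹ y) = y := fun y => by
    rw [← Homeomorph.mul_apply, mul_inv_cancel, Homeomorph.one_apply]
  rw [Homeomorph.mul_apply, Homeomorph.mul_apply, ← hR, h, hθ, hR]

/-- The automorphism `γ(θ) = R ∘ θ ∘ R⁻¹` of the deck group, for a lift `R` of `T`. -/
def gamma {p : E → X} {T : X ≃ₜ X} {R : E ≃ₜ E} (hR : ∀ x, p (R x) = T (p x)) :
    MulAut (deckGroup p) where
  toFun θ := ⟨R * θ * R⁻¹, conj_mem_deckGroup hR θ.2⟩
  invFun θ := ⟨R⁻¹ * θ * R, conj_inv_mem_deckGroup hR θ.2⟩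
  left_inv θ := Subtype.ext (by simp [mul_assoc])
  right_inv θ := Subtype.ext (by simp [mul_assoc])
  map_mul' θ θ' := Subtype.ext (by simp [mul_assoc])

/-- The semidirect product `Θ ⋊_γ ℤ`, with `(θ, m) (θ', m') = (θ ∘ γ^m(θ'), m + m')`. -/
abbrev DeckProduct {p : E → X} {T : X ≃ₜ X} {R : E ≃ₜ E} (hR : ∀ x, p (R x) = T (p x)) : Type _ :=
  deckGroup p ⋊[zpowersHom (MulAut (deckGroup p)) (gamma hR)] Multiplicative ℤ

namespace DeckProduct

variable {p : E → X} {T : X ≃ₜ X} {R : E ≃ₜ E} {hR : ∀ x, p (R x) = T (p x)}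

/-- The `ℤ`-coordinate `m` of `(θ, m)`. -/
def exponent (w : DeckProduct hR) : ℤ := w.right.toAdd

/-- The action `(θ, m)(x) = θ (R^m x)` of `Θ ⋊_γ ℤ` on `E`. -/
def act (w : DeckProduct hR) (x : E) : E := (w.left : E ≃ₜ E) ((R ^ w.exponent) x)

end DeckProduct

end Deck

end SpecialFlow

open Topology
namespace SpecialFlow

/-! ### Lifting and descending homeomorphisms along covering maps -/

section Covering

variable {E B : Type*} [TopologicalSpace E] [TopologicalSpace B] {p : E → B}

/-! Write `E` for the universal cover, `R` for the lift of `T`, and Γ for the semidirect product Θ ⋊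
ℤ. Γ acts on `E × ℝ` by `(x, r) ↦ (w x, r - f^{(m)} x)`, where `m` is the exponent of `w`, with
orbit space `X^f`. As `f` is bounded away from zero with constant sign, this is a covering action
(`isQuotientCoveringMap_spaceProj`), and `E × ℝ` is simply connected. Hence homeomorphisms `S` of
`X^f` correspond to homeomorphisms `Q` of `E × ℝ` that are equivariant up to an automorphism `A` of
Γ (`exists_equivariant_lift`, `exists_descent`).

If `S` conjugates the flow to its rescaling by `s`, then `Q` stretches vertical lines by `s`, so `Q
(x, r) = (V x, s r + h x)`. The two coordinates of the equivariance of `Q` are the two required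
equations (`topConjugate_rescale_iff`), up to replacing `s` by its inverse. -/

theorem exists_homeomorph_lift [SimplyConnectedSpace E] [LocallyPathConnectedSpace E]
    (hp : IsCoveringMap p) (S : B ≃ₜ B) {e e' : E} (h : p e' = S (p e)) :
    ∃ R : E ≃ₜ E, R e = e' ∧ ∀ x, p (R x) = S (p x) := by
  obtain ⟨F, ⟨hFe, hF⟩, -⟩ := hp.existsUnique_continuousMap_lifts
    (⟨fun x => S (p x), S.continuous.comp hp.continuous⟩ : C(E, B)) e e' h
  obtain ⟨F', ⟨hFe', hF'⟩, -⟩ := hp.existsUnique_continuousMap_lifts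
    (⟨fun x => S.symm (p x), S.symm.continuous.comp hp.continuous⟩ : C(E, B)) e' e
    (by simp [h])
  have hF (x : E) : p (F x) = S (p x) := congr_fun hF x
  have hF' (x : E) : p (F' x) = S.symm (p x) := congr_fun hF' x
  -- Both composites cover the identity and fix a point, so uniqueness of lifts applies.
  have h₁ : F' ∘ F = id := hp.eq_of_comp_eq (F'.continuous.comp F.continuous) continuous_id
    (funext fun x => by simp [hF', hF]) e (by simp [hFe, hFe'])
  have h₂ : F ∘ F' = id := hp.eq_of_comp_eq (F.continuous.comp F'.continuous) continuous_id
    (funext fun x => by simp [hF', hF]) e' (by simp [hFe, hFe'])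
  exact ⟨⟨⟨F, F', congr_fun h₁, congr_fun h₂⟩, F.continuous, F'.continuous⟩, hFe, hF⟩

/-- The local homeomorphisms given by `p` serve as charts of `E` modelled on `B`. -/
theorem locallyPathConnectedSpace_of_isCoveringMap [LocallyPathConnectedSpace B]
    (hp : IsCoveringMap p) : LocallyPathConnectedSpace E := by
  choose c hc _ using hp.isLocalHomeomorph
  let : ChartedSpace B E :=
    { atlas := Set.range c
      chartAt := c
      mem_chart_source := hc
      chart_mem_atlas := Set.mem_range_self }
  exact ChartedSpace.locallyPathConnectedSpace B E

theorem surjective_of_isCoveringMap [Nonempty E] [PathConnectedSpace B] (hp : IsCoveringMap p) :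
    Function.Surjective p := fun y => by
  inhabit E
  let γ : Path (p default) y := PathConnectedSpace.somePath _ _
  obtain ⟨Γ, hΓ, -⟩ := hp.exists_path_lifts γ.toContinuousMap default γ.source
  exact ⟨Γ 1, (congr_fun hΓ 1).trans γ.target⟩

/-- `R ∘ g` and `g' ∘ R` lift the same map, so they agree once they agree at `e`, which fixes `g'`.
Freeness makes `g'` unique, hence `g ↦ g'` multiplicative. -/
theorem exists_equivariant_lift {G : Type*} [Group G] [MulAction G E] [SimplyConnectedSpace E]
    [LocallyPathConnectedSpace E] (hp : IsQuotientCoveringMap p G) (S : B ≃ₜ B) :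
    ∃ (R : E ≃ₜ E) (A : G ≃* G), (∀ x, p (R x) = S (p x)) ∧ ∀ (g : G) x, R (g • x) = A g • R x := by
  have := hp.toContinuousConstSMul
  have hfree := hp.isCancelSMul
  have e : E := (inferInstance : Nonempty E).some
  obtain ⟨e', he'⟩ := hp.surjective (S (p e))
  obtain ⟨R, -, hR⟩ := exists_homeomorph_lift hp.isCoveringMap S he'
  have hex (g : G) : ∃ g' : G, ∀ x, R (g • x) = g' • R x := by
    obtain ⟨g', hg'⟩ := hp.apply_eq_iff_mem_orbit.mp
      (show p (R (g • e)) = p (R e) by rw [hR, hR, hp.map_smul])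
    refine ⟨g', congr_fun (hp.isCoveringMap.eq_of_comp_eq (R.continuous.comp
      (continuous_const_smul g)) (R.continuous.const_smul g') (funext fun x => ?_) e hg'.symm)⟩
    simp [hp.map_smul, hR]
  choose A hA using hex
  have huniq {g g' : G} {x : E} (h : g • x = g' • x) : g = g' := hfree.right_cancel' _ _ _ h
  have hmul (g g' : G) : A (g * g') = A g * A g' :=
    huniq (x := R e) (by rw [← hA, mul_smul, hA, hA, mul_smul])
  have hbij : Function.Bijective A := by
    refine ⟨fun g g' h => huniq (x := e) (R.injective (by rw [hA, hA, h])), fun g' => ?_⟩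
    obtain ⟨g, hg⟩ := hp.apply_eq_iff_mem_orbit.mp
      (show p (R.symm (g' • R e)) = p e from S.injective (by
        rw [← hR, R.apply_symm_apply, hp.map_smul, hR]))
    refine ⟨g, huniq (x := R e) ?_⟩
    rw [← hA]
    exact (congrArg R hg).trans (R.apply_symm_apply _)
  exact ⟨R, MulEquiv.ofBijective (⟨⟨A, huniq (x := R e) (by rw [← hA, one_smul, one_smul])⟩, hmul⟩ :
    G →* G) hbij, hR, hA⟩

theorem exists_descent {G : Type*} [Group G] [MulAction G E] (hp : IsQuotientCoveringMap p G)
    (R : E ≃ₜ E) (A : G ≃* G) (h : ∀ (g : G) x, R (g • x) = A g • R x) :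
    ∃ S : B ≃ₜ B, ∀ x, S (p x) = p (R x) := by
  have key {x y : E} : p x = p y ↔ p (R x) = p (R y) := by
    simp only [hp.apply_eq_iff_mem_orbit, MulAction.mem_orbit_iff]
    constructor
    · rintro ⟨g, rfl⟩
      exact ⟨A g, (h g y).symm⟩
    · rintro ⟨g, hg⟩
      exact ⟨A.symm g, R.injective (by rw [h, A.apply_symm_apply, hg])⟩
  -- The inverse satisfies `S' ∘ p ∘ R = p`, so its continuity is tested along `p ∘ R`.
  have hq : IsQuotientMap (p ∘ R) := hp.toIsQuotientMap.comp R.isQuotientMap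
  let S : B → B := fun b => p (R (Function.surjInv hp.surjective b))
  have hS (x : E) : S (p x) = p (R x) := key.mp (Function.surjInv_eq hp.surjective (p x))
  let S' : B → B := fun b => p (R.symm (Function.surjInv hp.surjective b))
  have hS' (x : E) : S' (p (R x)) = p x := by
    refine key.mpr ?_
    rw [R.apply_symm_apply]
    exact Function.surjInv_eq hp.surjective _
  refine ⟨⟨⟨S, S', ?_, ?_⟩, ?_, ?_⟩, hS⟩
  · intro b
    obtain ⟨x, rfl⟩ := hp.surjective b
    rw [hS, hS']
  · intro b
    obtain ⟨x, rfl⟩ := hq.surjective b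
    simp only [Function.comp_apply]
    rw [hS', hS]
  · refine hp.continuous_iff.mpr ?_
    rw [show S ∘ p = p ∘ R from funext hS]
    exact hq.continuous
  · refine hq.continuous_iff.mpr ?_
    rw [show S' ∘ p ∘ R = p from funext hS']
    exact hp.continuous

end Covering

/-- Homotopy classes of paths in a product are pairs of classes. Used for `E × ℝ`. -/
instance simplyConnectedSpace_prod {Y Z : Type*} [TopologicalSpace Y] [TopologicalSpace Z]
    [SimplyConnectedSpace Y] [SimplyConnectedSpace Z] : SimplyConnectedSpace (Y × Z) := by
  refine simply_connected_iff_paths_homotopic.mpr ⟨inferInstance, fun x y => ⟨fun a b => ?_⟩⟩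
  rw [← Path.Homotopic.prod_projLeft_projRight a, ← Path.Homotopic.prod_projLeft_projRight b]
  congr 1 <;> exact Subsingleton.elim _ _

/-! ### Cocycles over a homeomorphism -/

section Cocycle

variable {X E : Type*} [TopologicalSpace X] [TopologicalSpace E]

theorem zpow_add_one_apply (R : X ≃ₜ X) (n : ℤ) (y : X) : (R ^ (n + 1)) y = R ((R ^ n) y) := by
  rw [add_comm, zpow_add, zpow_one, Homeomorph.mul_apply]

theorem cocycle_zero (R : X ≃ₜ X) (h : X → ℝ) (y : X) : cocycle R h 0 y = 0 := by simp [cocycle]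

theorem cocycle_add_one (R : X ≃ₜ X) (h : X → ℝ) (k : ℤ) (y : X) :
    cocycle R h (k + 1) y = cocycle R h k y + h ((R ^ k) y) := by
  unfold cocycle
  rcases le_or_gt 0 k with hk | hk
  · rw [Finset.Ico_eq_empty (a := k) (by omega), Finset.Ico_eq_empty (a := k + 1) (by omega),
      show Finset.Ico 0 (k + 1) = insert k (Finset.Ico 0 k) by ext; simp; omega,
      Finset.sum_insert (by simp)]
    simp [add_comm]
  · rw [Finset.Ico_eq_empty (b := k) (by omega), Finset.Ico_eq_empty (b := k + 1) (by omega),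
      show Finset.Ico k 0 = insert k (Finset.Ico (k + 1) 0) by ext; simp; omega,
      Finset.sum_insert (by simp)]
    simp

/-- Links the orbit relation to the cocycle; the cocycle identity is then the law of exponents read
in the second coordinate. -/
theorem skewProduct_zpow_apply (T : X ≃ₜ X) (f : C(X, ℝ)) (n : ℤ) (q : X × ℝ) :
    (skewProduct T f ^ n) q = ((T ^ n) q.1, q.2 - cocycle T f n q.1) := by
  have step (n : ℤ) : ((T ^ (n + 1)) q.1, q.2 - cocycle T f (n + 1) q.1) =
      skewProduct T f ((T ^ n) q.1, q.2 - cocycle T f n q.1) := by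
    rw [cocycle_add_one, zpow_add_one_apply]
    exact Prod.ext rfl (sub_add_eq_sub_sub _ _ _)
  induction n using Int.induction_on with
  | zero => simp [cocycle_zero]
  | succ n ih => rw [zpow_add_one_apply, step, ih]
  | pred n ih =>
    apply (skewProduct T f).injective
    rw [← zpow_add_one_apply, ← step, sub_add_cancel, ih]

theorem cocycle_add (T : X ≃ₜ X) (f : C(X, ℝ)) (m n : ℤ) (y : X) :
    cocycle T f (m + n) y = cocycle T f n y + cocycle T f m ((T ^ n) y) := by
  have h : (skewProduct T f ^ (m + n)) (y, 0) =
      (skewProduct T f ^ m) ((skewProduct T f ^ n) (y, 0)) := by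
    rw [zpow_add, Homeomorph.mul_apply]
  simp only [skewProduct_zpow_apply] at h
  have := congrArg Prod.snd h
  simp only at this
  linarith

theorem map_zpow_of_semiconj {p : E → X} {T : X ≃ₜ X} {R : E ≃ₜ E} (hR : ∀ x, p (R x) = T (p x))
    (n : ℤ) (x : E) : p ((R ^ n) x) = (T ^ n) (p x) := by
  induction n using Int.induction_on with
  | zero => simp
  | succ n ih => rw [zpow_add_one_apply, zpow_add_one_apply, hR, ih]
  | pred n ih =>
    apply T.injective
    rw [← hR, ← zpow_add_one_apply, ← zpow_add_one_apply, sub_add_cancel, ih]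

theorem cocycle_comp {p : E → X} {T : X ≃ₜ X} {R : E ≃ₜ E} (hR : ∀ x, p (R x) = T (p x))
    (f : X → ℝ) (k : ℤ) (x : E) : cocycle R (f ∘ p) k x = cocycle T f k (p x) := by
  simp [cocycle, map_zpow_of_semiconj hR]

/-- All summands have the same sign, so a single one already gives the bound. -/
theorem le_abs_cocycle {δ : ℝ} {f : X → ℝ} (hδ : 0 ≤ δ)
    (hf : (∀ x, δ ≤ f x) ∨ ∀ x, f x ≤ -δ) (T : X ≃ₜ X) {k : ℤ} (hk : k ≠ 0) (y : X) :
    δ ≤ |cocycle T f k y| := by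
  have pos {f : X → ℝ} (hf : ∀ x, δ ≤ f x) : δ ≤ |cocycle T f k y| := by
    have h₀ (i : ℤ) : 0 ≤ f ((T ^ i) y) := hδ.trans (hf _)
    unfold cocycle
    rcases hk.lt_or_gt with hk | hk
    · rw [Finset.Ico_eq_empty (b := k) (by omega), Finset.sum_empty, zero_sub, abs_neg]
      exact (hf _).trans ((Finset.single_le_sum (fun i _ => h₀ i)
        (Finset.mem_Ico.mpr ⟨le_rfl, hk⟩)).trans (le_abs_self _))
    · rw [Finset.Ico_eq_empty (a := k) (by omega), Finset.sum_empty, sub_zero]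
      exact (hf _).trans ((Finset.single_le_sum (fun i _ => h₀ i)
        (Finset.mem_Ico.mpr ⟨le_rfl, hk⟩)).trans (le_abs_self _))
  rcases hf with hf | hf
  · exact pos hf
  · have := pos (f := fun x => -f x) fun x => le_neg.mpr (hf x)
    rwa [show cocycle T (fun x => -f x) k y = -cocycle T f k y by
      simp [cocycle, Finset.sum_neg_distrib]; ring, abs_neg] at this

theorem exists_pos_le_of_pos_or_neg [CompactSpace X] [Nonempty X] (f : C(X, ℝ))
    (hf : (∀ x, 0 < f x) ∨ ∀ x, f x < 0) :
    ∃ δ > 0, (∀ x, δ ≤ f x) ∨ ∀ x, f x ≤ -δ := by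
  rcases hf with hf | hf
  · obtain ⟨a, -, ha⟩ := isCompact_univ.exists_isMinOn Set.univ_nonempty f.continuous.continuousOn
    exact ⟨f a, hf a, .inl fun x => ha (Set.mem_univ x)⟩
  · obtain ⟨a, -, ha⟩ := isCompact_univ.exists_isMaxOn Set.univ_nonempty f.continuous.continuousOn
    exact ⟨-f a, neg_pos.mpr (hf a), .inr fun x => (neg_neg (f a)).symm ▸ ha (Set.mem_univ x)⟩

end Cocycle

/-! ### The covering of `X^f` by `E × ℝ` -/

section Action

variable {X E : Type*} [TopologicalSpace X] [TopologicalSpace E]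

theorem gamma_zpow_apply {p : E → X} {T : X ≃ₜ X} {R : E ≃ₜ E} (hR : ∀ x, p (R x) = T (p x))
    (n : ℤ) (θ : deckGroup p) :
    (((gamma hR ^ n) θ : deckGroup p) : E ≃ₜ E) = R ^ n * θ * R ^ (-n) := by
  have step (n : ℤ) : (((gamma hR ^ (n + 1)) θ : deckGroup p) : E ≃ₜ E) =
      R * ((gamma hR ^ n) θ : deckGroup p) * R⁻¹ := by
    rw [add_comm, zpow_add, zpow_one, MulAut.mul_apply]
    rfl
  induction n using Int.induction_on with
  | zero => simp
  | succ n ih =>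
    rw [step, ih]
    group
  | pred n ih =>
    have h := step (-n - 1)
    rw [sub_add_cancel, ih] at h
    rw [← mul_left_cancel_iff (a := R), ← mul_right_cancel_iff (a := R⁻¹), ← h]
    group

namespace DeckProduct

variable {p : E → X} {T : X ≃ₜ X} {R : E ≃ₜ E} {hR : ∀ x, p (R x) = T (p x)}

theorem exponent_mul (w w' : DeckProduct hR) :
    (w * w').exponent = w.exponent + w'.exponent := rfl

theorem act_one (x : E) : (1 : DeckProduct hR).act x = x := by
  simp [act, exponent]

theorem act_mul (w w' : DeckProduct hR) (x : E) : (w * w').act x = w.act (w'.act x) := by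
  have h : (((w * w').left : deckGroup p) : E ≃ₜ E) * R ^ (w * w').exponent =
      (w.left * R ^ w.exponent) * (w'.left * R ^ w'.exponent) := by
    have : ((w * w').left : deckGroup p) = w.left * (gamma hR ^ w.exponent) w'.left := by
      simp [SemidirectProduct.mul_left, exponent, zpowersHom_apply]
    rw [this, exponent_mul, Subgroup.coe_mul, gamma_zpow_apply]
    group
  exact congrArg (fun Q : E ≃ₜ E => Q x) h

theorem map_act (w : DeckProduct hR) (x : E) : p (w.act x) = (T ^ w.exponent) (p x) := by
  rw [act, w.left.2, map_zpow_of_semiconj hR]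

theorem continuous_act (w : DeckProduct hR) : Continuous w.act :=
  (w.left : E ≃ₜ E).continuous.comp (R ^ w.exponent).continuous

theorem cocycle_mul (f : C(X, ℝ)) (w w' : DeckProduct hR) (x : E) :
    cocycle R (f ∘ p) (w * w').exponent x =
      cocycle R (f ∘ p) w'.exponent x + cocycle R (f ∘ p) w.exponent (w'.act x) := by
  simp only [cocycle_comp hR, exponent_mul, map_act, cocycle_add]

/-- The action `(θ, m) (x, r) = (θ (R^m x), r - f^{(m)} (x))` of `Θ ⋊_γ ℤ` on `E × ℝ`, whose orbit
space is `X^f`. -/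
@[reducible] noncomputable def mulAction (hR : ∀ x, p (R x) = T (p x)) (f : C(X, ℝ)) :
    MulAction (DeckProduct hR) (E × ℝ) where
  smul w q := (w.act q.1, q.2 - cocycle R (f ∘ p) w.exponent q.1)
  one_smul q := Prod.ext (act_one q.1) (by
    change q.2 - cocycle R (f ∘ p) 0 q.1 = q.2
    rw [cocycle_zero, sub_zero])
  mul_smul w w' q := Prod.ext (act_mul w w' q.1) (by
    change q.2 - cocycle R (f ∘ p) (w * w').exponent q.1 =
      q.2 - cocycle R (f ∘ p) w'.exponent q.1 - cocycle R (f ∘ p) w.exponent (w'.act q.1)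
    rw [cocycle_mul, sub_add_eq_sub_sub])

end DeckProduct

/-- The projection of `E × ℝ` onto `X^f`. -/
def spaceProj (p : E → X) (T : X ≃ₜ X) (f : C(X, ℝ)) (q : E × ℝ) : Space T f :=
  Quotient.mk (orbitSetoid T f) (p q.1, q.2)

theorem specialFlow_spaceProj {E : Type*} (p : E → X) (T : X ≃ₜ X) (f : C(X, ℝ)) (t : ℝ)
    (q : E × ℝ) :
    specialFlow T f t (spaceProj p T f q) = spaceProj p T f (q.1, q.2 + t) := rfl

theorem exists_deck_apply_eq [SimplyConnectedSpace E] [LocallyPathConnectedSpace E] {p : E → X}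
    (hp : IsCoveringMap p) {x y : E} (h : p x = p y) : ∃ θ : deckGroup p, (θ : E ≃ₜ E) x = y := by
  obtain ⟨θ, hθ, h'⟩ := exists_homeomorph_lift hp (Homeomorph.refl X) h.symm
  exact ⟨⟨θ, h'⟩, hθ⟩

theorem isQuotientCoveringMap_spaceProj [CompactSpace X] [SimplyConnectedSpace E]
    [LocallyPathConnectedSpace E] {p : E → X} (hp : IsCoveringMap p)
    (hsurj : Function.Surjective p) {T : X ≃ₜ X} {R : E ≃ₜ E} (hR : ∀ x, p (R x) = T (p x))
    (f : C(X, ℝ)) (hf : (∀ x, 0 < f x) ∨ ∀ x, f x < 0) :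
    letI := DeckProduct.mulAction hR f
    IsQuotientCoveringMap (spaceProj p T f) (DeckProduct hR) := by
  let := DeckProduct.mulAction hR f
  have hsmul (w : DeckProduct hR) (q : E × ℝ) :
      w • q = (w.act q.1, q.2 - cocycle R (f ∘ p) w.exponent q.1) := rfl
  have hopen : IsOpenQuotientMap p := ⟨hsurj, hp.continuous, hp.isOpenMap⟩
  have : Nonempty X := ⟨p (inferInstance : Nonempty E).some⟩
  refine
    { toIsQuotientMap := ((isOpenQuotientMap_mk T f).comp
        (hopen.prodMap IsOpenQuotientMap.id)).isQuotientMap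
      continuous_const_smul := fun w => ?_
      apply_eq_iff_mem_orbit := fun {a b} => ?_
      disjoint := fun a => ?_ }
  · refine (w.continuous_act.comp continuous_fst).prodMk (continuous_snd.sub ?_)
    have : Continuous (cocycle R (f ∘ p) w.exponent) := by
      have (i : ℤ) : Continuous fun y => (f ∘ p) ((R ^ i) y) :=
        (f.continuous.comp hp.continuous).comp (R ^ i).continuous
      exact (continuous_finsetSum _ fun i _ => this i).sub
        (continuous_finsetSum _ fun i _ => this i)
    exact this.comp continuous_fst
  · rw [MulAction.mem_orbit_iff]
    constructor
    · intro h
      obtain ⟨n, hn⟩ := (Quotient.exact h.symm : (orbitSetoid T f).r (p b.1, b.2) (p a.1, a.2))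
      rw [skewProduct_zpow_apply] at hn
      obtain ⟨h₁, h₂⟩ := Prod.ext_iff.mp hn
      simp only [← map_zpow_of_semiconj hR] at h₁ h₂
      obtain ⟨θ, hθ⟩ := exists_deck_apply_eq hp h₁.symm
      refine ⟨⟨θ, Multiplicative.ofAdd n⟩, Prod.ext hθ ?_⟩
      rw [hsmul, h₂]
      exact congrArg (b.2 - ·) (cocycle_comp hR f n b.1)
    · rintro ⟨w, rfl⟩
      refine Quotient.sound ((orbitSetoid T f).symm ⟨w.exponent, ?_⟩)
      rw [skewProduct_zpow_apply, hsmul, DeckProduct.map_act (hR := hR), cocycle_comp hR]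
  · obtain ⟨δ, hδ, hfδ⟩ := exists_pos_le_of_pos_or_neg f hf
    obtain ⟨U, hU, haU, hinj⟩ := hp.isLocalHomeomorph.isLocallyInjective a.1
    -- Heights in the ball differ by less than `δ`, which forces exponent zero. What remains is a
    -- deck transformation; injectivity of `p` on `U` gives it a fixed point, so it is the identity.
    refine ⟨U ×ˢ Metric.ball a.2 (δ / 2),
      prod_mem_nhds (hU.mem_nhds haU) (Metric.ball_mem_nhds _ (half_pos hδ)), fun w => ?_⟩
    rintro ⟨_, ⟨⟨x, r⟩, ⟨hx, hr⟩, rfl⟩, hwx, hwr⟩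
    simp only [hsmul, Metric.mem_ball, Real.dist_eq] at hx hr hwx hwr
    have hexp : w.exponent = 0 := by
      by_contra hne
      have h := le_abs_cocycle hδ.le hfδ T hne (p x)
      rw [← cocycle_comp hR] at h
      rw [abs_lt] at hr hwr
      rcases le_abs.mp h with h | h <;> linarith
    have hact (y : E) : w.act y = (w.left : E ≃ₜ E) y := by
      rw [DeckProduct.act, hexp, zpow_zero, Homeomorph.one_apply]
    have hfix : (w.left : E ≃ₜ E) x = x :=
      hinj (hact x ▸ hwx) hx (w.left.2 x)
    have hid : ⇑(w.left : E ≃ₜ E) = id :=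
      hp.eq_of_comp_eq (w.left : E ≃ₜ E).continuous continuous_id (funext w.left.2) x hfix
    exact SemidirectProduct.ext (Subtype.ext (Homeomorph.ext (congr_fun hid)))
      (Multiplicative.toAdd.injective hexp)

theorem topConjugate_rescale_iff [CompactSpace X] [SimplyConnectedSpace E]
    [LocallyPathConnectedSpace E] {p : E → X} (hp : IsCoveringMap p)
    (hsurj : Function.Surjective p) {T : X ≃ₜ X} {R : E ≃ₜ E} (hR : ∀ x, p (R x) = T (p x))
    (f : C(X, ℝ)) (hf : (∀ x, 0 < f x) ∨ ∀ x, f x < 0) {s : ℝ} (hs : s ≠ 0) :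
    TopConjugate (specialFlow T f) (rescale (specialFlow T f) s) ↔
      ∃ (V : E ≃ₜ E) (A : DeckProduct hR ≃* DeckProduct hR) (h : C(E, ℝ)),
        ∀ (w : DeckProduct hR) (x : E), V (w.act x) = (A w).act (V x) ∧
          cocycle R (f ∘ p) (A w).exponent (V x) - s * cocycle R (f ∘ p) w.exponent x =
            h x - h (w.act x) := by
  let := DeckProduct.mulAction hR f
  have hq : IsQuotientCoveringMap (spaceProj p T f) (DeckProduct hR) :=
    isQuotientCoveringMap_spaceProj hp hsurj hR f hf
  have hsmul (w : DeckProduct hR) (q : E × ℝ) :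
      w • q = (w.act q.1, q.2 - cocycle R (f ∘ p) w.exponent q.1) := rfl
  constructor
  · rintro ⟨S, hS⟩
    obtain ⟨Q, A, hQ, hA⟩ := exists_equivariant_lift hq S
    -- Both sides, as curves in `r`, lift the same rescaled flow orbit in `X^f` and agree at `r =
    -- 0`.
    have hfib (x : E) (r : ℝ) : Q (x, r) = ((Q (x, 0)).1, (Q (x, 0)).2 + s * r) := by
      refine congr_fun (hq.isCoveringMap.eq_of_comp_eq (g₁ := fun r => Q (x, r))
        (g₂ := fun r => ((Q (x, 0)).1, (Q (x, 0)).2 + s * r)) (by fun_prop) (by fun_prop)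
        (funext fun r => ?_) 0 (by simp)) r
      have h := hS r (spaceProj p T f (x, 0))
      rw [specialFlow_spaceProj, zero_add, ← hQ, ← hQ] at h
      exact h
    let V : E ≃ₜ E :=
      { toFun x := (Q (x, 0)).1
        invFun x := (Q.symm (x, 0)).1
        left_inv x := by
          -- This is the height over `x` that `Q` sends to height zero.
          have : Q (x, -(Q (x, 0)).2 / s) = ((Q (x, 0)).1, 0) := by
            rw [hfib, mul_div_cancel₀ _ hs, add_neg_cancel]
          change (Q.symm ((Q (x, 0)).1, 0)).1 = x
          rw [← this, Q.symm_apply_apply]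
        right_inv x := by
          have h := hfib (Q.symm (x, 0)).1 (Q.symm (x, 0)).2
          rw [Prod.mk.eta, Q.apply_symm_apply] at h
          exact (congrArg Prod.fst h).symm
        continuous_toFun := by fun_prop
        continuous_invFun := by fun_prop }
    refine ⟨V, A, ⟨fun x => (Q (x, 0)).2, by fun_prop⟩, fun w x => ?_⟩
    have h := hA w (x, 0)
    rw [hsmul, hsmul, hfib] at h
    obtain ⟨h₁, h₂⟩ := Prod.ext_iff.mp h
    refine ⟨h₁, ?_⟩
    simp only [ContinuousMap.coe_mk] at h₂ ⊢
    change cocycle R (f ∘ p) (A w).exponent (Q (x, 0)).1 - _ = _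
    linarith
  · rintro ⟨V, A, h, hV⟩
    let Q : (E × ℝ) ≃ₜ (E × ℝ) :=
      { toFun q := (V q.1, s * q.2 + h q.1)
        invFun q := (V.symm q.1, (q.2 - h (V.symm q.1)) / s)
        left_inv q := Prod.ext (by simp) (by simp [hs])
        right_inv q := Prod.ext (by simp) (by simp [mul_div_cancel₀ _ hs])
        continuous_toFun := by fun_prop
        continuous_invFun := by fun_prop }
    have hQ (q : E × ℝ) : Q q = (V q.1, s * q.2 + h q.1) := rfl
    obtain ⟨S, hS⟩ := exists_descent hq Q A fun w q => by
      obtain ⟨h₁, h₂⟩ := hV w q.1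
      rw [hsmul, hsmul, hQ, hQ]
      refine Prod.ext h₁ ?_
      simp only
      linarith
    refine ⟨S, fun t y => ?_⟩
    obtain ⟨q, rfl⟩ := hq.surjective y
    rw [specialFlow_spaceProj, hS, hS]
    change _ = specialFlow T f (s * t) (spaceProj p T f (Q q))
    rw [specialFlow_spaceProj, hQ, hQ]
    refine congrArg (spaceProj p T f) (Prod.ext rfl ?_)
    simp only
    ring

end Action

end SpecialFlow

open SpecialFlow in
theorem mainTheorem9 {n : ℕ} {X Xt : Type*} [TopologicalSpace X] [T2Space X] [CompactSpace X]
    [ConnectedSpace X] [ChartedSpace (EuclideanSpace ℝ (Fin n)) X]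
    [TopologicalSpace Xt] [SimplyConnectedSpace Xt]
    (π : Xt → X) (hπ : IsCoveringMap π)
    (T : X ≃ₜ X) (f : C(X, ℝ)) (hf : (∀ x, 0 < f x) ∨ (∀ x, f x < 0))
    (Tt : Xt ≃ₜ Xt) (hTt : ∀ x, π (Tt x) = T (π x)) (s : ℝˣ) :
    s ∈ topSelfSimilarityGroup (specialFlow T f) ↔
      ∃ (V : Xt ≃ₜ Xt) (A : DeckProduct hTt ≃* DeckProduct hTt) (g : C(Xt, ℝ)),
        ∀ (w : DeckProduct hTt) (x : Xt),
          V (w.act x) = (A w).act (V x) ∧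
          (s : ℝ) * cocycle Tt (f ∘ π) (A w).exponent (V x) - cocycle Tt (f ∘ π) w.exponent x =
            g x - g (w.act x) := by
  have := ChartedSpace.locallyPathConnectedSpace (EuclideanSpace ℝ (Fin n)) X
  have := locallyPathConnectedSpace_of_isCoveringMap hπ
  have : PathConnectedSpace X := pathConnectedSpace_iff_connectedSpace.mpr inferInstance
  have hsurj := surjective_of_isCoveringMap hπ
  have hs : (s : ℝ) * ((s⁻¹ : ℝˣ) : ℝ) = 1 := s.mul_inv
  -- `topConjugate_rescale_iff` puts the scalar on the other cocycle. Applying it to the inverse of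
  -- `s` and multiplying by `s` moves it across, with `g = s h`.
  rw [← inv_mem_iff]
  refine (topConjugate_rescale_iff hπ hsurj hTt f hf (s⁻¹).ne_zero).trans ⟨?_, ?_⟩
  · rintro ⟨V, A, h, hV⟩
    refine ⟨V, A, (s : ℝ) • h, fun w x => ⟨(hV w x).1, ?_⟩⟩
    have := (hV w x).2
    simp only [ContinuousMap.smul_apply, smul_eq_mul, ← mul_sub, ← this]
    rw [mul_sub, ← mul_assoc, hs, one_mul]
  · rintro ⟨V, A, g, hV⟩
    refine ⟨V, A, ((s⁻¹ : ℝˣ) : ℝ) • g, fun w x => ⟨(hV w x).1, ?_⟩⟩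
    have := (hV w x).2
    simp only [ContinuousMap.smul_apply, smul_eq_mul, ← mul_sub, ← this]
    rw [mul_sub, ← mul_assoc, mul_comm _ (s : ℝ), hs, one_mul]
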